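/- Let $$A = \begin{pmatrix} -6 & -3 & 0 & 1 \\ -3 & -6 & 1 & 0 \\ -35 & -45 & 6 & 3 \\ -45 & -35 & 3 & 6 \\ 1&0&0&0 \\ 0&1&0&0 \\ 0&0&1&0 \\ 0&0&0&1 \end{pmatrix},\qquad b = (-1,-1,-8,-8,0,0,0,0)^T,$$ and let $\tilde U_4=\{x\in\mathbb{R}^4 : Ax\ge b\}$ be the (unbounded) Klee–Walkup polyhedron. A realization of $U_4$ is a $4$-dimensional polyhedron $P=\{x\in\mathbb{R}^n : A^1x=b^1,\ A^2x\ge b^2\}$, given by real matrices and vectors, whose face lattice is isomorphic to that of $\tilde U_4$. A circuit of $(A^1,A^2)$ is a vector $g\in\ker(A^1)\setminus\{0\}$ for which $A^2g$ is support-minimal in $\{A^2x : x\in\ker(A^1)\setminus\{0\}\}$. A circuit walk of length $k$ from a vertex $u$ to a vertex $v$ of $P$ is a sequence $u=y^0,\dots,y^k=v$ of points of $P$ such that for every $i<k$ there are a circuit $g^i$ and $\alpha_i>0$ with $y^{i+1}-y^i=\alpha_i g^i$ and $y^i+\alpha g^i\notin P$ for all $\alpha>\alpha_i$. The circuit distance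 from $u$ to $v$ is the length of a shortest circuit walk from $u$ to $v$ ($\infty$ if there is none), and the circuit diameter of $P$, with respect to the given system, is the largest circuit distance over all ordered pairs of vertices. Theorem. Every realization of $U_4$, with respect to every system presenting it, has circuit diameter at most $4$. Moreover, the number $f$ of its facets and its dimension $d$ satisfy $f-d=4$, so its circuit diameter satisfies the Hirsch bound $f-d$. -/

import Mathlib

open scoped Matrix

/-- The polyhedron `{x ∈ ℝⁿ : A₁ x = b₁, A₂ x ≥ b₂}` presented by the system `(A₁, b₁, A₂, b₂)`. -/
def polyhedron {n p m : ℕ} (A₁ : Matrix (Fin p) (Fin n) ℝ) (b₁ : Fin p → ℝ)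
    (A₂ : Matrix (Fin m) (Fin n) ℝ) (b₂ : Fin m → ℝ) : Set (Fin n → ℝ) :=
  {x | A₁ *ᵥ x = b₁ ∧ ∀ i, b₂ i ≤ (A₂ *ᵥ x) i}

/-- `g` is a circuit (elementary vector) of `(A₁, A₂)`: a nonzero element of `ker A₁` such that
`A₂ g` is support-minimal in `{A₂ x : x ∈ ker A₁ \ {0}}`. Circuits are not normalized, because
only their directions matter for circuit walks. -/
def IsCircuit {n p m : ℕ} (A₁ : Matrix (Fin p) (Fin n) ℝ) (A₂ : Matrix (Fin m) (Fin n) ℝ)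
    (g : Fin n → ℝ) : Prop :=
  A₁ *ᵥ g = 0 ∧ g ≠ 0 ∧ ∀ h : Fin n → ℝ, A₁ *ᵥ h = 0 → h ≠ 0 →
    ¬ Function.support (A₂ *ᵥ h) ⊂ Function.support (A₂ *ᵥ g)

/-- `x → y` is a circuit step: `y = x + α g` with `g` a circuit and `α > 0`, and the step is
maximal, i.e. `x + β g` leaves the polyhedron for every `β > α`. -/
def IsCircuitStep {n p m : ℕ} (A₁ : Matrix (Fin p) (Fin n) ℝ) (b₁ : Fin p → ℝ)
    (A₂ : Matrix (Fin m) (Fin n) ℝ) (b₂ : Fin m → ℝ) (x y : Fin n → ℝ) : Prop :=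
  ∃ g : Fin n → ℝ, ∃ α : ℝ, IsCircuit A₁ A₂ g ∧ 0 < α ∧ y - x = α • g ∧
    ∀ β : ℝ, α < β → x + β • g ∉ polyhedron A₁ b₁ A₂ b₂

/-- `y 0, …, y k` is a circuit walk of length `k` from `u` to `v`. -/
def IsCircuitWalk {n p m : ℕ} (A₁ : Matrix (Fin p) (Fin n) ℝ) (b₁ : Fin p → ℝ)
    (A₂ : Matrix (Fin m) (Fin n) ℝ) (b₂ : Fin m → ℝ) (u v : Fin n → ℝ)
    (k : ℕ) (y : Fin (k + 1) → Fin n → ℝ) : Prop :=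
  y 0 = u ∧ y (Fin.last k) = v ∧ (∀ i, y i ∈ polyhedron A₁ b₁ A₂ b₂) ∧
    ∀ i : Fin k, IsCircuitStep A₁ b₁ A₂ b₂ (y i.castSucc) (y i.succ)

/-- The circuit distance from `u` to `v`: the length of a shortest circuit walk from `u` to `v`
(`⊤` if there is none). -/
noncomputable def circuitDist {n p m : ℕ} (A₁ : Matrix (Fin p) (Fin n) ℝ) (b₁ : Fin p → ℝ)
    (A₂ : Matrix (Fin m) (Fin n) ℝ) (b₂ : Fin m → ℝ) (u v : Fin n → ℝ) : ℕ∞ :=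
  ⨅ (k : ℕ) (_ : ∃ y, IsCircuitWalk A₁ b₁ A₂ b₂ u v k y), (k : ℕ∞)

/-- The circuit diameter: the largest circuit distance from a vertex to a vertex. -/
noncomputable def circuitDiameter {n p m : ℕ} (A₁ : Matrix (Fin p) (Fin n) ℝ) (b₁ : Fin p → ℝ)
    (A₂ : Matrix (Fin m) (Fin n) ℝ) (b₂ : Fin m → ℝ) : ℕ∞ :=
  ⨆ u ∈ (polyhedron A₁ b₁ A₂ b₂).extremePoints ℝ,
    ⨆ v ∈ (polyhedron A₁ b₁ A₂ b₂).extremePoints ℝ, circuitDist A₁ b₁ A₂ b₂ u v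

/-- The faces of `P` (including `∅` and `P`), ordered by inclusion: the sets of maximizers over
`P` of a linear functional, and the empty set. -/
abbrev PolyFace {n : ℕ} (P : Set (Fin n → ℝ)) : Type :=
  {F : Set (Fin n → ℝ) // IsExposed ℝ P F}

/-- Combinatorial equivalence: the face lattices are isomorphic. -/
def CombEquiv {n k : ℕ} (P : Set (Fin n → ℝ)) (Q : Set (Fin k → ℝ)) : Prop :=
  Nonempty (PolyFace P ≃o PolyFace Q)

/-- The dimension of (the affine hull of) `P`. -/
noncomputable def polyDim {n : ℕ} (P : Set (Fin n → ℝ)) : ℕ :=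
  Module.finrank ℝ (vectorSpan ℝ P)

/-- The number of facets of `P`, the maximal nonempty proper faces. -/
noncomputable def numFacets {n : ℕ} (P : Set (Fin n → ℝ)) : ℕ :=
  Set.ncard {F : Set (Fin n → ℝ) |
    Maximal (fun G : Set (Fin n → ℝ) => IsExposed ℝ P G ∧ G.Nonempty ∧ G ≠ P) F}

/-- The matrix of the Klee–Walkup system. -/
def kleeWalkupA : Matrix (Fin 8) (Fin 4) ℝ :=
  !![ -6,  -3, 0, 1;
      -3,  -6, 1, 0;
     -35, -45, 6, 3;
     -45, -35, 3, 6;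
       1,   0, 0, 0;
       0,   1, 0, 0;
       0,   0, 1, 0;
       0,   0, 0, 1]

/-- The right-hand side of the Klee–Walkup system. -/
def kleeWalkupB : Fin 8 → ℝ :=
  ![-1, -1, -8, -8, 0, 0, 0, 0]

/-- The Klee–Walkup polyhedron `{x ∈ ℝ⁴ : A x ≥ b}`, which defines the combinatorial class `U₄`. -/
def kleeWalkup : Set (Fin 4 → ℝ) :=
  {x | ∀ i, kleeWalkupB i ≤ (kleeWalkupA *ᵥ x) i}

/-- `P` is a realization of `U₄`: a 4-dimensional polyhedron (polyhedrality is given by the system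
that presents `P`) combinatorially equivalent to the Klee–Walkup polyhedron. -/
def IsRealizationU4 {n : ℕ} (P : Set (Fin n → ℝ)) : Prop :=
  polyDim P = 4 ∧ CombEquiv P kleeWalkup

section Faces

variable {n p m : ℕ} {A₁ : Matrix (Fin p) (Fin n) ℝ} {b₁ : Fin p → ℝ}
  {A₂ : Matrix (Fin m) (Fin n) ℝ} {b₂ : Fin m → ℝ}

/-- The face of a polyhedron on which the inequalities indexed by `S` hold with equality. -/
def tightFace (A₁ : Matrix (Fin p) (Fin n) ℝ) (b₁ : Fin p → ℝ)
    (A₂ : Matrix (Fin m) (Fin n) ℝ) (b₂ : Fin m → ℝ) (S : Set (Fin m)) : Set (Fin n → ℝ) :=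
  {x | x ∈ polyhedron A₁ b₁ A₂ b₂ ∧ ∀ i ∈ S, (A₂ *ᵥ x) i = b₂ i}

theorem tightFace_subset (S : Set (Fin m)) :
    tightFace A₁ b₁ A₂ b₂ S ⊆ polyhedron A₁ b₁ A₂ b₂ := fun _ hx => hx.1

theorem tightFace_anti {S T : Set (Fin m)} (h : S ⊆ T) :
    tightFace A₁ b₁ A₂ b₂ T ⊆ tightFace A₁ b₁ A₂ b₂ S :=
  fun _ hx => ⟨hx.1, fun i hi => hx.2 i (h hi)⟩

theorem tightFace_empty : tightFace A₁ b₁ A₂ b₂ ∅ = polyhedron A₁ b₁ A₂ b₂ := by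
  ext x; simp [tightFace]

theorem mulVec_add_smul_apply (M : Matrix (Fin m) (Fin n) ℝ) (x d : Fin n → ℝ) (t : ℝ)
    (i : Fin m) : (M *ᵥ (x + t • d)) i = (M *ᵥ x) i + t * (M *ᵥ d) i := by
  simp [Matrix.mulVec_add, Matrix.mulVec_smul]

theorem mulVec_sub_apply (M : Matrix (Fin m) (Fin n) ℝ) (x y : Fin n → ℝ) (i : Fin m) :
    (M *ᵥ (x - y)) i = (M *ᵥ x) i - (M *ᵥ y) i := by
  simp [Matrix.mulVec_sub]

theorem mulVec_sub_eq_zero {x y : Fin n → ℝ} (hx : x ∈ polyhedron A₁ b₁ A₂ b₂)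
    (hy : y ∈ polyhedron A₁ b₁ A₂ b₂) : A₁ *ᵥ (x - y) = 0 := by
  rw [Matrix.mulVec_sub, hx.1, hy.1, sub_self]

theorem mulVec_add_smul_eq {x d : Fin n → ℝ} (hx : x ∈ polyhedron A₁ b₁ A₂ b₂)
    (hd : A₁ *ᵥ d = 0) (t : ℝ) : A₁ *ᵥ (x + t • d) = b₁ := by
  rw [Matrix.mulVec_add, Matrix.mulVec_smul, hx.1, hd, smul_zero, add_zero]

theorem isExposed_tightFace (S : Set (Fin m)) :
    IsExposed ℝ (polyhedron A₁ b₁ A₂ b₂) (tightFace A₁ b₁ A₂ b₂ S) := by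
  classical
  rintro ⟨z, hz⟩
  let l : (Fin n → ℝ) →ₗ[ℝ] ℝ :=
    -∑ i ∈ Finset.univ.filter (· ∈ S), (LinearMap.proj i).comp (Matrix.mulVecLin A₂)
  have hl : ∀ x, l x = -∑ i ∈ Finset.univ.filter (· ∈ S), (A₂ *ᵥ x) i := by
    intro x; simp [l]
  refine ⟨LinearMap.toContinuousLinearMap l, ?_⟩
  ext x
  simp only [Set.mem_ofPred_eq, LinearMap.coe_toContinuousLinearMap', hl]
  constructor
  · intro hx
    refine ⟨hx.1, fun y hy => neg_le_neg (Finset.sum_le_sum fun i hi => ?_)⟩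
    rw [hx.2 i (by simpa using hi)]
    exact hy.2 i
  · rintro ⟨hx, h⟩
    refine ⟨hx, ?_⟩
    have h1 : ∑ i ∈ Finset.univ.filter (· ∈ S), (A₂ *ᵥ x) i
        ≤ ∑ i ∈ Finset.univ.filter (· ∈ S), b₂ i := by
      refine (neg_le_neg_iff.1 (h z hz.1)).trans (Finset.sum_le_sum fun i hi => ?_)
      rw [hz.2 i (by simpa using hi)]
    have h2 := (Finset.sum_eq_sum_iff_of_le (s := Finset.univ.filter (· ∈ S))
      (f := b₂) (g := A₂ *ᵥ x) fun i _ => hx.2 i).1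
      (le_antisymm (Finset.sum_le_sum fun i _ => hx.2 i) h1)
    exact fun i hi => (h2 i (by simpa using hi)).symm

/-- A small move in any direction does not violate strict inequalities. -/
theorem exists_pos_forall_add_mul_nonneg {ι : Type*} [Finite ι] (s c : ι → ℝ) :
    ∃ ε : ℝ, 0 < ε ∧ ∀ i, 0 < s i → 0 ≤ s i + ε * c i := by
  have h : ∀ᶠ ε in nhdsWithin (0 : ℝ) (Set.Ioi 0), ∀ i, 0 < s i → 0 ≤ s i + ε * c i := by
    refine Filter.eventually_all.2 fun i => ?_
    by_cases hs : 0 < s i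
    · have ht : Filter.Tendsto (fun ε : ℝ => s i + ε * c i) (nhdsWithin 0 (Set.Ioi 0))
          (nhds (s i + 0 * c i)) :=
        Filter.Tendsto.mono_left (Continuous.tendsto (by fun_prop) 0) nhdsWithin_le_nhds
      have := ht.eventually (lt_mem_nhds (a := 0) (by simpa using hs))
      filter_upwards [this] with ε hε _ using hε.le
    · exact Filter.Eventually.of_forall fun ε h => absurd h hs
  obtain ⟨ε, h1, h2⟩ := (h.and self_mem_nhdsWithin).exists
  exact ⟨ε, h2, h1⟩

/-- A nonempty convex subset of a polyhedron has a point at which only those inequalities are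
tight that are tight on the whole subset. -/
theorem exists_relative_interior_point {F : Set (Fin n → ℝ)} (hF : F ⊆ polyhedron A₁ b₁ A₂ b₂)
    (hc : Convex ℝ F) (hne : F.Nonempty) :
    ∃ x ∈ F, ∀ i, (A₂ *ᵥ x) i = b₂ i → ∀ y ∈ F, (A₂ *ᵥ y) i = b₂ i := by
  classical
  let f : (Fin n → ℝ) → ℕ := fun x => (Finset.univ.filter fun i => (A₂ *ᵥ x) i = b₂ i).card
  have hx := Function.argminOn_mem f F hne
  have hmin := fun y (hy : y ∈ F) => Function.argminOn_le f F hy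
  set x := Function.argminOn f F hne
  refine ⟨x, hx, fun i hi y hy => ?_⟩
  by_contra hyi
  have hz : x + (1 / 2 : ℝ) • (y - x) ∈ F := by
    have := hc.add_smul_sub_mem hx hy (t := 1 / 2) ⟨by norm_num, by norm_num⟩
    exact this
  refine absurd (hmin _ hz) (not_le.2 (Finset.card_lt_card ?_))
  have key : ∀ k, (A₂ *ᵥ (x + (1 / 2 : ℝ) • (y - x))) k
      = ((A₂ *ᵥ x) k + (A₂ *ᵥ y) k) / 2 := by
    intro k
    rw [mulVec_add_smul_apply, mulVec_sub_apply]; ring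
  refine Finset.ssubset_iff_of_subset (fun k hk => ?_) |>.2 ⟨i, by simpa using hi, ?_⟩
  · simp only [Finset.mem_filter, Finset.mem_univ, true_and, key] at hk ⊢
    have := (hF hx).2 k
    have := (hF hy).2 k
    linarith
  · simp only [Finset.mem_filter, Finset.mem_univ, true_and, key]
    intro h
    exact hyi (by linarith)

theorem convex_polyhedron : Convex ℝ (polyhedron A₁ b₁ A₂ b₂) := by
  intro x hx y hy a b ha hb hab
  refine ⟨?_, fun i => ?_⟩
  · rw [Matrix.mulVec_add, Matrix.mulVec_smul, Matrix.mulVec_smul, hx.1, hy.1, ← add_smul, hab,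
      one_smul]
  · have h1 := mul_le_mul_of_nonneg_left (hx.2 i) ha
    have h2 := mul_le_mul_of_nonneg_left (hy.2 i) hb
    simp only [Matrix.mulVec_add, Matrix.mulVec_smul, Pi.add_apply, Pi.smul_apply, smul_eq_mul]
    calc b₂ i = a * b₂ i + b * b₂ i := by rw [← add_mul, hab, one_mul]
      _ ≤ _ := add_le_add h1 h2

/-- Every nonempty exposed face of a polyhedron is cut out by the inequalities tight on it. -/
theorem IsExposed.eq_tightFace {F : Set (Fin n → ℝ)}
    (hF : IsExposed ℝ (polyhedron A₁ b₁ A₂ b₂) F) (hne : F.Nonempty) :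
    F = tightFace A₁ b₁ A₂ b₂ {i | ∀ x ∈ F, (A₂ *ᵥ x) i = b₂ i} := by
  refine Set.Subset.antisymm (fun x hx => ⟨hF.subset hx, fun i hi => hi x hx⟩) ?_
  intro y hy
  obtain ⟨x, hx, hxi⟩ :=
    exists_relative_interior_point hF.subset (hF.convex convex_polyhedron) hne
  obtain ⟨l, hl⟩ := hF hne
  have hxP := hF.subset hx
  obtain ⟨ε, hε, hs⟩ := exists_pos_forall_add_mul_nonneg
    (fun i => (A₂ *ᵥ x) i - b₂ i) (fun i => (A₂ *ᵥ (x - y)) i)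
  have hz : x + ε • (x - y) ∈ polyhedron A₁ b₁ A₂ b₂ := by
    refine ⟨mulVec_add_smul_eq hxP (mulVec_sub_eq_zero hxP hy.1) ε, fun i => ?_⟩
    rw [mulVec_add_smul_apply]
    rcases (hxP.2 i).eq_or_lt with h | h
    · rw [mulVec_sub_apply, hy.2 i (hxi i h.symm), ← h]; simp
    · have := hs i (sub_pos.2 h)
      linarith
  rw [hl] at hx ⊢
  refine ⟨hy.1, fun w hw => (hx.2 w hw).trans ?_⟩
  have := hx.2 _ hz
  simp only [map_add, map_smul, map_sub, smul_eq_mul] at this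
  nlinarith

/-- The ratio test: a ray that violates an inequality eventually leaves the polyhedron at a point
where a decreasing inequality becomes tight. -/
theorem exists_exit_point {x d : Fin n → ℝ} (hx : x ∈ polyhedron A₁ b₁ A₂ b₂)
    (hd : A₁ *ᵥ d = 0) {i : Fin m} (hi : (A₂ *ᵥ d) i < 0) :
    ∃ t : ℝ, 0 ≤ t ∧ x + t • d ∈ polyhedron A₁ b₁ A₂ b₂ ∧
      ∃ j, (A₂ *ᵥ d) j < 0 ∧ (A₂ *ᵥ (x + t • d)) j = b₂ j := by
  classical
  obtain ⟨j, hj, hmin⟩ := Finset.exists_min_image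
    (Finset.univ.filter fun k => (A₂ *ᵥ d) k < 0)
    (fun k => ((A₂ *ᵥ x) k - b₂ k) / (-(A₂ *ᵥ d) k)) ⟨i, by simpa using hi⟩
  simp only [Finset.mem_filter, Finset.mem_univ, true_and] at hj hmin
  have ht : 0 ≤ ((A₂ *ᵥ x) j - b₂ j) / (-(A₂ *ᵥ d) j) :=
    div_nonneg (sub_nonneg.2 (hx.2 j)) (by linarith)
  refine ⟨_, ht, ⟨mulVec_add_smul_eq hx hd _, fun k => ?_⟩, j, hj, ?_⟩
  · rw [mulVec_add_smul_apply]
    by_cases hk : (A₂ *ᵥ d) k < 0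
    · have := (le_div_iff₀ (by linarith)).1 (hmin k hk)
      linarith
    · have := mul_nonneg ht (not_lt.1 hk)
      have := hx.2 k
      linarith
  · rw [mulVec_add_smul_apply]
    have : (A₂ *ᵥ d) j ≠ 0 := hj.ne
    field_simp
    ring

theorem mem_tightFace_add_smul {S : Set (Fin m)} {x d : Fin n → ℝ} {t : ℝ}
    (hx : x ∈ tightFace A₁ b₁ A₂ b₂ S) (hd : ∀ i ∈ S, (A₂ *ᵥ d) i = 0)
    (h : x + t • d ∈ polyhedron A₁ b₁ A₂ b₂) : x + t • d ∈ tightFace A₁ b₁ A₂ b₂ S :=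
  ⟨h, fun i hi => by rw [mulVec_add_smul_apply, hx.2 i hi, hd i hi]; simp⟩

theorem mulVec_sub_of_mem_tightFace {S : Set (Fin m)} {x y : Fin n → ℝ}
    (hx : x ∈ tightFace A₁ b₁ A₂ b₂ S) (hy : y ∈ tightFace A₁ b₁ A₂ b₂ S) :
    ∀ i ∈ S, (A₂ *ᵥ (x - y)) i = 0 := fun i hi => by
  rw [mulVec_sub_apply, hx.2 i hi, hy.2 i hi, sub_self]

/-- In a pointed polyhedron, the minimal nonempty faces are points. -/
theorem tightFace_subsingleton_of_minimal
    (hpt : ∀ d, A₁ *ᵥ d = 0 → A₂ *ᵥ d = 0 → d = 0) {S : Set (Fin m)}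
    (hmin : ∀ T, S ⊆ T → (tightFace A₁ b₁ A₂ b₂ T).Nonempty →
      tightFace A₁ b₁ A₂ b₂ S ⊆ tightFace A₁ b₁ A₂ b₂ T) :
    (tightFace A₁ b₁ A₂ b₂ S).Subsingleton := by
  have main : ∀ x ∈ tightFace A₁ b₁ A₂ b₂ S, ∀ y ∈ tightFace A₁ b₁ A₂ b₂ S,
      ∀ i, 0 ≤ (A₂ *ᵥ (x - y)) i := by
    intro x hx y hy i
    by_contra! hi
    have hd := mulVec_sub_eq_zero hx.1 hy.1
    obtain ⟨t, -, hz, j, hj, hzj⟩ := exists_exit_point hx.1 hd hi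
    have hzS := mem_tightFace_add_smul hx (mulVec_sub_of_mem_tightFace hx hy) hz
    have hsub := hmin (S ∪ {j}) Set.subset_union_left ⟨_, hz, by
      rintro k (hk | rfl)
      exacts [hzS.2 k hk, hzj]⟩
    have h1 := (hsub hx).2 j (Or.inr rfl)
    have h2 := (hsub hy).2 j (Or.inr rfl)
    rw [mulVec_sub_apply] at hj
    linarith
  intro x hx y hy
  refine sub_eq_zero.1 (hpt _ (mulVec_sub_eq_zero hx.1 hy.1) (funext fun i => ?_))
  have h1 := main x hx y hy i
  have h2 := main y hy x hx i
  rw [mulVec_sub_apply] at h1 h2 ⊢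
  simp only [Pi.zero_apply]
  linarith

/-- If every nonempty proper face of a face is the point `w`, then the face is a ray from `w` as
soon as it has another point. -/
theorem add_smul_mem_of_forall_face_eq {S : Set (Fin m)} {w x : Fin n → ℝ}
    (hw : w ∈ tightFace A₁ b₁ A₂ b₂ S) (hx : x ∈ tightFace A₁ b₁ A₂ b₂ S) (hne : x ≠ w)
    (hmin : ∀ T, S ⊆ T → (tightFace A₁ b₁ A₂ b₂ T).Nonempty →
      tightFace A₁ b₁ A₂ b₂ S ⊆ tightFace A₁ b₁ A₂ b₂ T ∨ tightFace A₁ b₁ A₂ b₂ T ⊆ {w})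
    {t : ℝ} (ht : 0 ≤ t) : w + t • (x - w) ∈ tightFace A₁ b₁ A₂ b₂ S := by
  have hd := mulVec_sub_eq_zero hx.1 hw.1
  have hdS := mulVec_sub_of_mem_tightFace hx hw
  have hnonneg : ∀ i, 0 ≤ (A₂ *ᵥ (x - w)) i := by
    intro i
    by_contra! hi
    obtain ⟨s, hs, hz, j, hj, hzj⟩ := exists_exit_point hx.1 hd hi
    have hzS := mem_tightFace_add_smul hx hdS hz
    have hzT : x + s • (x - w) ∈ tightFace A₁ b₁ A₂ b₂ (S ∪ {j}) := ⟨hz, by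
      rintro k (hk | rfl)
      exacts [hzS.2 k hk, hzj]⟩
    rcases hmin (S ∪ {j}) Set.subset_union_left ⟨_, hzT⟩ with hsub | hsub
    · have h1 := (hsub hx).2 j (Or.inr rfl)
      have h2 := (hsub hw).2 j (Or.inr rfl)
      rw [mulVec_sub_apply] at hj
      linarith
    · have h : x + s • (x - w) = w := hsub hzT
      have h' : (1 + s) • (x - w) = 0 := by
        rw [add_smul, one_smul, sub_add_eq_add_sub, h, sub_self]
      rcases smul_eq_zero.1 h' with h' | h'
      · linarith
      · exact hne (sub_eq_zero.1 h')
  refine mem_tightFace_add_smul hw hdS ⟨mulVec_add_smul_eq hw.1 hd t, fun i => ?_⟩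
  rw [mulVec_add_smul_apply]
  have := hw.1.2 i
  have := mul_nonneg ht (hnonneg i)
  linarith

/-- A polyhedron is described by the inequalities tight on all of it and by one inequality for each
of a family of faces that covers all proper faces. -/
theorem mem_polyhedron_of_facet_inequalities {ι : Type*} {r : ι → Fin m}
    (hne : (polyhedron A₁ b₁ A₂ b₂).Nonempty)
    (hproper : ∀ i, tightFace A₁ b₁ A₂ b₂ {r i} ≠ polyhedron A₁ b₁ A₂ b₂)
    (hcover : ∀ j, tightFace A₁ b₁ A₂ b₂ {j} ≠ polyhedron A₁ b₁ A₂ b₂ →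
      (tightFace A₁ b₁ A₂ b₂ {j}).Nonempty →
      ∃ i, tightFace A₁ b₁ A₂ b₂ {j} ⊆ tightFace A₁ b₁ A₂ b₂ {r i})
    {x : Fin n → ℝ} (hx : A₁ *ᵥ x = b₁)
    (hx0 : ∀ j, tightFace A₁ b₁ A₂ b₂ {j} = polyhedron A₁ b₁ A₂ b₂ → (A₂ *ᵥ x) j = b₂ j)
    (hxr : ∀ i, b₂ (r i) ≤ (A₂ *ᵥ x) (r i)) : x ∈ polyhedron A₁ b₁ A₂ b₂ := by
  obtain ⟨c, hc, hci⟩ := exists_relative_interior_point subset_rfl convex_polyhedron hne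
  have hc' : ∀ j, (A₂ *ᵥ c) j = b₂ j →
      tightFace A₁ b₁ A₂ b₂ {j} = polyhedron A₁ b₁ A₂ b₂ := fun j hj =>
    (tightFace_subset _).antisymm fun y hy => ⟨hy, by rintro k rfl; exact hci k hj y hy⟩
  refine ⟨hx, fun i => ?_⟩
  by_contra! hi
  have hd : A₁ *ᵥ (x - c) = 0 := by rw [Matrix.mulVec_sub, hx, hc.1, sub_self]
  have hdi : (A₂ *ᵥ (x - c)) i < 0 := by
    rw [mulVec_sub_apply]; linarith [hc.2 i]
  obtain ⟨t, ht, hz, j, hj, hzj⟩ := exists_exit_point hc hd hdi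
  have ht1 : t < 1 := by
    have := hz.2 i
    rw [mulVec_add_smul_apply] at this
    rw [mulVec_sub_apply] at this hdi
    by_contra! h1
    nlinarith
  have hjP : tightFace A₁ b₁ A₂ b₂ {j} ≠ polyhedron A₁ b₁ A₂ b₂ := by
    intro h
    rw [mulVec_sub_apply, hx0 j h] at hj
    linarith [hc.2 j, (show c ∈ tightFace A₁ b₁ A₂ b₂ {j} from h ▸ hc).2 j rfl]
  have hzT : c + t • (x - c) ∈ tightFace A₁ b₁ A₂ b₂ {j} := ⟨hz, by rintro k rfl; exact hzj⟩
  obtain ⟨k, hk⟩ := hcover j hjP ⟨_, hzT⟩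
  have h1 := (hk hzT).2 (r k) rfl
  rw [mulVec_add_smul_apply, mulVec_sub_apply] at h1
  have h2 : b₂ (r k) < (A₂ *ᵥ c) (r k) :=
    lt_of_le_of_ne (hc.2 _) fun h => hproper k (hc' _ h.symm)
  nlinarith [hxr k, mul_nonneg ht (sub_nonneg.2 (hxr k)), mul_pos (sub_pos.2 ht1) (sub_pos.2 h2)]

/-- The inequalities tight at an extreme point determine it. -/
theorem eq_zero_of_mem_extremePoints {u d : Fin n → ℝ}
    (hu : u ∈ (polyhedron A₁ b₁ A₂ b₂).extremePoints ℝ) (hd : A₁ *ᵥ d = 0)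
    (hdt : ∀ i, (A₂ *ᵥ u) i = b₂ i → (A₂ *ᵥ d) i = 0) : d = 0 := by
  have key : ∀ s : ℝ, ∃ ε : ℝ, 0 < ε ∧
      u + (ε * s) • d ∈ polyhedron A₁ b₁ A₂ b₂ := by
    intro s
    obtain ⟨ε, hε, h⟩ := exists_pos_forall_add_mul_nonneg
      (fun i => (A₂ *ᵥ u) i - b₂ i) (fun i => s * (A₂ *ᵥ d) i)
    refine ⟨ε, hε, mulVec_add_smul_eq hu.1 hd _, fun i => ?_⟩
    rw [mulVec_add_smul_apply]
    rcases (hu.1.2 i).eq_or_lt with h' | h'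
    · rw [hdt i h'.symm, ← h']; simp
    · have := h i (sub_pos.2 h')
      linarith
  obtain ⟨ε₁, h₁, hz₁⟩ := key 1
  obtain ⟨ε₂, h₂, hz₂⟩ := key (-1)
  have hseg : u ∈ openSegment ℝ (u + (ε₁ * 1) • d) (u + (ε₂ * (-1)) • d) := by
    refine ⟨ε₂ / (ε₁ + ε₂), ε₁ / (ε₁ + ε₂), by positivity, by positivity, by field_simp; ring, ?_⟩
    ext k
    simp only [Pi.add_apply, Pi.smul_apply, smul_eq_mul]
    field_simp
    ring
  have := hu.2 hz₁ hz₂ hseg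
  have h0 : (ε₁ * 1) • d = 0 := by simpa using this
  exact (smul_eq_zero.1 h0).resolve_left (by positivity)

theorem tightFace_eq_singleton_of_mem_extremePoints {u : Fin n → ℝ}
    (hu : u ∈ (polyhedron A₁ b₁ A₂ b₂).extremePoints ℝ) :
    tightFace A₁ b₁ A₂ b₂ {i | (A₂ *ᵥ u) i = b₂ i} = {u} := by
  refine Set.Subset.antisymm (fun x hx => ?_) (by rintro _ rfl; exact ⟨hu.1, fun i hi => hi⟩)
  refine sub_eq_zero.1 (eq_zero_of_mem_extremePoints hu (mulVec_sub_eq_zero hx.1 hu.1) fun i hi => ?_)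
  rw [mulVec_sub_apply, hx.2 i hi, hi, sub_self]

end Faces

/-- The vertices of the Klee–Walkup polyhedron, given by the four inequalities tight at each. -/
def kwLabel : Fin 15 → Finset (Fin 8) :=
  ![{0, 1, 2, 3}, {0, 2, 3, 4}, {0, 3, 4, 7}, {0, 3, 5, 6}, {0, 3, 6, 7}, {0, 5, 6, 7},
    {1, 2, 3, 5}, {1, 2, 4, 7}, {1, 2, 5, 6}, {1, 2, 6, 7}, {1, 4, 6, 7}, {2, 3, 4, 7},
    {2, 3, 5, 6}, {2, 3, 6, 7}, {4, 5, 6, 7}]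

/-- The minimal sets of facets of the Klee–Walkup polyhedron without a common point. -/
def kwNonface : List (Fin 8 × Fin 8 × Fin 8) :=
  [(0, 1, 4), (0, 1, 5), (0, 1, 6), (0, 1, 7), (0, 2, 5), (0, 2, 6), (0, 2, 7), (0, 4, 5),
    (0, 4, 6), (1, 3, 4), (1, 3, 6), (1, 3, 7), (1, 4, 5), (1, 5, 7), (2, 4, 5), (2, 4, 6),
    (2, 5, 7), (3, 4, 5), (3, 4, 6), (3, 5, 7)]

theorem card_kwLabel (a : Fin 15) : (kwLabel a).card = 4 := by
  revert a; decide

theorem kwLabel_eq_of_subset {a b : Fin 15} (h : kwLabel a ⊆ kwLabel b) :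
    kwLabel a = kwLabel b :=
  Finset.eq_of_subset_of_card_le h (by rw [card_kwLabel, card_kwLabel])

set_option maxRecDepth 100000 in
theorem exists_subset_kwLabel : ∀ T : Finset (Fin 8),
    (∀ N ∈ kwNonface, ¬ (N.1 ∈ T ∧ N.2.1 ∈ T ∧ N.2.2 ∈ T)) → ∃ a, T ⊆ kwLabel a := by
  decide

theorem eq_of_forall_kwLabel : ∀ i j : Fin 8,
    (∀ a, i ∈ kwLabel a → j ∈ kwLabel a) → i = j := by
  decide

theorem exists_mem_kwLabel : ∀ i : Fin 8, ∃ a, i ∈ kwLabel a := by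
  decide

section Labelling

variable {n p m : ℕ}

/-- The face of a polyhedron on which the inequalities labelled by `T` hold with equality. -/
abbrev labelledFace (A₁ : Matrix (Fin p) (Fin n) ℝ) (b₁ : Fin p → ℝ)
    (A₂ : Matrix (Fin m) (Fin n) ℝ) (b₂ : Fin m → ℝ) (r : Fin 8 → Fin m)
    (T : Finset (Fin 8)) : Set (Fin n → ℝ) :=
  tightFace A₁ b₁ A₂ b₂ (r '' T)

/-- The labels `r` identify the face lattice of a polyhedron with that of the Klee–Walkup
polyhedron. The last three fields record as much of the injectivity as is needed. -/
structure IsKleeWalkupLabelling (A₁ : Matrix (Fin p) (Fin n) ℝ) (b₁ : Fin p → ℝ)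
    (A₂ : Matrix (Fin m) (Fin n) ℝ) (b₂ : Fin m → ℝ) (r : Fin 8 → Fin m) : Prop where
  exists_eq : ∀ F, IsExposed ℝ (polyhedron A₁ b₁ A₂ b₂) F → F.Nonempty →
    ∃ T, F = labelledFace A₁ b₁ A₂ b₂ r T
  nonempty_iff : ∀ T, (labelledFace A₁ b₁ A₂ b₂ r T).Nonempty ↔ ∃ a, T ⊆ kwLabel a
  ne_of_ray : labelledFace A₁ b₁ A₂ b₂ r {1, 5, 6} ≠ labelledFace A₁ b₁ A₂ b₂ r (kwLabel 8)
  ne_of_ray' : labelledFace A₁ b₁ A₂ b₂ r {0, 3, 5} ≠ labelledFace A₁ b₁ A₂ b₂ r (kwLabel 3)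
  ne_univ : ∀ i, labelledFace A₁ b₁ A₂ b₂ r {i} ≠ polyhedron A₁ b₁ A₂ b₂

variable {A₁ : Matrix (Fin p) (Fin n) ℝ} {b₁ : Fin p → ℝ}
  {A₂ : Matrix (Fin m) (Fin n) ℝ} {b₂ : Fin m → ℝ} {r : Fin 8 → Fin m}

theorem labelledFace_anti {S T : Finset (Fin 8)} (h : S ⊆ T) :
    labelledFace A₁ b₁ A₂ b₂ r T ⊆ labelledFace A₁ b₁ A₂ b₂ r S :=
  tightFace_anti (Set.image_mono (by exact_mod_cast h))

theorem mem_labelledFace {T : Finset (Fin 8)} {x : Fin n → ℝ} :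
    x ∈ labelledFace A₁ b₁ A₂ b₂ r T ↔
      x ∈ polyhedron A₁ b₁ A₂ b₂ ∧ ∀ i ∈ T, (A₂ *ᵥ x) (r i) = b₂ (r i) := by
  simp [labelledFace, tightFace]

theorem labelledFace_union (S T : Finset (Fin 8)) :
    labelledFace A₁ b₁ A₂ b₂ r (S ∪ T) =
      labelledFace A₁ b₁ A₂ b₂ r S ∩ labelledFace A₁ b₁ A₂ b₂ r T := by
  ext x
  simp only [Set.mem_inter_iff, mem_labelledFace, Finset.mem_union]
  grind

theorem labelledFace_singleton (i : Fin 8) :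
    labelledFace A₁ b₁ A₂ b₂ r {i} = tightFace A₁ b₁ A₂ b₂ {r i} := by
  simp [labelledFace]

namespace IsKleeWalkupLabelling

theorem mem_kwLabel_of_subset (h : IsKleeWalkupLabelling A₁ b₁ A₂ b₂ r) {a : Fin 15}
    {T : Finset (Fin 8)}
    (hT : (labelledFace A₁ b₁ A₂ b₂ r (kwLabel a) ∩ labelledFace A₁ b₁ A₂ b₂ r T).Nonempty) :
    T ⊆ kwLabel a := by
  rw [← labelledFace_union, h.nonempty_iff] at hT
  obtain ⟨c, hc⟩ := hT
  rw [kwLabel_eq_of_subset (Finset.union_subset_left hc)]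
  exact Finset.union_subset_right hc

theorem eq_of_singleton_subset (h : IsKleeWalkupLabelling A₁ b₁ A₂ b₂ r) {i j : Fin 8}
    (hij : labelledFace A₁ b₁ A₂ b₂ r {i} ⊆ labelledFace A₁ b₁ A₂ b₂ r {j}) : i = j := by
  refine eq_of_forall_kwLabel i j fun a hi => ?_
  obtain ⟨x, hx⟩ := (h.nonempty_iff (kwLabel a)).2 ⟨a, subset_rfl⟩
  have := h.mem_kwLabel_of_subset (a := a) (T := {j})
    ⟨x, hx, hij (labelledFace_anti (by simpa using hi) hx)⟩
  simpa using this

theorem maximal_singleton (h : IsKleeWalkupLabelling A₁ b₁ A₂ b₂ r) (i : Fin 8) :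
    Maximal (fun G => IsExposed ℝ (polyhedron A₁ b₁ A₂ b₂) G ∧ G.Nonempty ∧
      G ≠ polyhedron A₁ b₁ A₂ b₂) (labelledFace A₁ b₁ A₂ b₂ r {i}) := by
  obtain ⟨a, ha⟩ := exists_mem_kwLabel i
  refine ⟨⟨isExposed_tightFace _, (h.nonempty_iff _).2 ⟨a, by simpa using ha⟩, h.ne_univ i⟩, ?_⟩
  rintro G ⟨hG, hne, hGP⟩ hle
  obtain ⟨T, rfl⟩ := h.exists_eq G hG hne
  have hT : T.Nonempty := by
    rw [Finset.nonempty_iff_ne_empty]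
    rintro rfl
    exact hGP (by simp [labelledFace, tightFace_empty])
  obtain ⟨j, hj⟩ := hT
  have hsub : labelledFace A₁ b₁ A₂ b₂ r T ⊆ labelledFace A₁ b₁ A₂ b₂ r {j} :=
    labelledFace_anti (by simpa using hj)
  rwa [← h.eq_of_singleton_subset (hle.trans hsub)] at hsub

theorem exists_subset_singleton (h : IsKleeWalkupLabelling A₁ b₁ A₂ b₂ r)
    {G : Set (Fin n → ℝ)} (hG : IsExposed ℝ (polyhedron A₁ b₁ A₂ b₂) G) (hne : G.Nonempty)
    (hGP : G ≠ polyhedron A₁ b₁ A₂ b₂) : ∃ i, G ⊆ labelledFace A₁ b₁ A₂ b₂ r {i} := by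
  obtain ⟨T, rfl⟩ := h.exists_eq G hG hne
  obtain ⟨j, hj⟩ : T.Nonempty := by
    rw [Finset.nonempty_iff_ne_empty]
    rintro rfl
    exact hGP (by simp [labelledFace, tightFace_empty])
  exact ⟨j, labelledFace_anti (by simpa using hj)⟩

theorem numFacets_eq (h : IsKleeWalkupLabelling A₁ b₁ A₂ b₂ r) :
    numFacets (polyhedron A₁ b₁ A₂ b₂) = 8 := by
  have hset : {F : Set (Fin n → ℝ) | Maximal (fun G : Set (Fin n → ℝ) =>
      IsExposed ℝ (polyhedron A₁ b₁ A₂ b₂) G ∧ G.Nonempty ∧ G ≠ polyhedron A₁ b₁ A₂ b₂) F} =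
      Set.range fun i => labelledFace A₁ b₁ A₂ b₂ r {i} := by
    ext F
    constructor
    · intro hF
      rw [Set.mem_ofPred_eq] at hF
      obtain ⟨i, hi⟩ := h.exists_subset_singleton hF.1.1 hF.1.2.1 hF.1.2.2
      exact ⟨i, (hF.eq_of_le (h.maximal_singleton i).1 hi).symm⟩
    · rintro ⟨i, rfl⟩
      exact h.maximal_singleton i
  have hinj : Function.Injective fun i => labelledFace A₁ b₁ A₂ b₂ r {i} :=
    fun i j hij => h.eq_of_singleton_subset (subset_of_eq hij)
  rw [numFacets, hset, ← Set.image_univ, Set.ncard_image_of_injective _ hinj, Set.ncard_univ]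
  simp

end IsKleeWalkupLabelling

end Labelling

section Transport

theorem PolyFace.eq_empty_of_orderIso {n k : ℕ} {P : Set (Fin n → ℝ)} {Q : Set (Fin k → ℝ)}
    (φ : PolyFace P ≃o PolyFace Q) {G : PolyFace P} (hG : G.1 = ∅) : (φ G).1 = ∅ := by
  have h : φ G ≤ ⟨∅, isExposed_empty⟩ := by
    rw [← φ.le_symm_apply]
    intro x hx
    rw [hG] at hx
    exact hx.elim
  exact Set.subset_empty_iff.1 h

theorem PolyFace.nonempty_orderIso_iff {n k : ℕ} {P : Set (Fin n → ℝ)} {Q : Set (Fin k → ℝ)}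
    (φ : PolyFace P ≃o PolyFace Q) {G : PolyFace P} : (φ G).1.Nonempty ↔ G.1.Nonempty := by
  simp only [Set.nonempty_iff_ne_empty, ne_eq, not_iff_not]
  refine ⟨fun h => ?_, PolyFace.eq_empty_of_orderIso φ⟩
  simpa using PolyFace.eq_empty_of_orderIso φ.symm h

theorem PolyFace.eq_top_of_orderIso {n k : ℕ} {P : Set (Fin n → ℝ)} {Q : Set (Fin k → ℝ)}
    (φ : PolyFace P ≃o PolyFace Q) {G : PolyFace P} (hG : G.1 = P) : (φ G).1 = Q := by
  have h : (⟨Q, IsExposed.refl Q⟩ : PolyFace Q) ≤ φ G := by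
    rw [← φ.symm_apply_le]
    intro x hx
    rw [hG]
    exact (φ.symm _).2.subset hx
  exact (φ G).2.subset.antisymm h

theorem PolyFace.eq_top_orderIso_iff {n k : ℕ} {P : Set (Fin n → ℝ)} {Q : Set (Fin k → ℝ)}
    (φ : PolyFace P ≃o PolyFace Q) {G : PolyFace P} : (φ G).1 = Q ↔ G.1 = P := by
  refine ⟨fun h => ?_, PolyFace.eq_top_of_orderIso φ⟩
  simpa using PolyFace.eq_top_of_orderIso φ.symm h

variable {n p m n' p' m' : ℕ} {A₁ : Matrix (Fin p) (Fin n) ℝ} {b₁ : Fin p → ℝ}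
  {A₂ : Matrix (Fin m) (Fin n) ℝ} {b₂ : Fin m → ℝ}
  {A₁' : Matrix (Fin p') (Fin n') ℝ} {b₁' : Fin p' → ℝ}
  {A₂' : Matrix (Fin m') (Fin n') ℝ} {b₂' : Fin m' → ℝ}

/-- A facet of a polyhedron is cut out by a single inequality of each presentation. -/
theorem exists_eq_tightFace_singleton {F : Set (Fin n → ℝ)}
    (hF : Maximal (fun G => IsExposed ℝ (polyhedron A₁ b₁ A₂ b₂) G ∧ G.Nonempty ∧
      G ≠ polyhedron A₁ b₁ A₂ b₂) F) : ∃ k, F = tightFace A₁ b₁ A₂ b₂ {k} := by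
  have hR := hF.1.1.eq_tightFace hF.1.2.1
  set R := {i | ∀ x ∈ F, (A₂ *ᵥ x) i = b₂ i}
  obtain ⟨k, hk, hkP⟩ : ∃ k ∈ R, tightFace A₁ b₁ A₂ b₂ {k} ≠ polyhedron A₁ b₁ A₂ b₂ := by
    by_contra! hall
    refine hF.1.2.2 (hF.1.1.subset.antisymm fun x hx => ?_)
    rw [hR]
    refine ⟨hx, fun k hk => ?_⟩
    rw [← hall k hk] at hx
    exact hx.2 k rfl
  have hsub : F ⊆ tightFace A₁ b₁ A₂ b₂ {k} := by
    rw [hR]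
    exact tightFace_anti (by simpa using hk)
  exact ⟨k, hF.eq_of_le ⟨isExposed_tightFace _, hF.1.2.1.mono hsub, hkP⟩ hsub⟩

theorem PolyFace.maximal_orderIso {n k : ℕ} {P : Set (Fin n → ℝ)} {Q : Set (Fin k → ℝ)}
    (φ : PolyFace P ≃o PolyFace Q) {G : PolyFace P}
    (hG : Maximal (fun G => IsExposed ℝ P G ∧ G.Nonempty ∧ G ≠ P) G.1) :
    Maximal (fun G => IsExposed ℝ Q G ∧ G.Nonempty ∧ G ≠ Q) (φ G).1 := by
  refine ⟨⟨(φ G).2, (PolyFace.nonempty_orderIso_iff φ).2 hG.1.2.1,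
    fun h => hG.1.2.2 ((PolyFace.eq_top_orderIso_iff φ).1 h)⟩, ?_⟩
  rintro H ⟨hH, hne, hHQ⟩ hle
  have hle' : G ≤ φ.symm ⟨H, hH⟩ := (φ.le_symm_apply).2 hle
  have := hG.2 ⟨(φ.symm ⟨H, hH⟩).2, (PolyFace.nonempty_orderIso_iff φ.symm).2 hne,
    fun h => hHQ ((PolyFace.eq_top_orderIso_iff φ.symm).1 h)⟩ hle'
  exact (φ.symm_apply_le).1 (show φ.symm ⟨H, hH⟩ ≤ G from this)

/-- Labellings are transported along isomorphisms of face lattices. -/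
theorem IsKleeWalkupLabelling.exists_of_orderIso {r' : Fin 8 → Fin m'}
    (h' : IsKleeWalkupLabelling A₁' b₁' A₂' b₂' r')
    (φ : PolyFace (polyhedron A₁ b₁ A₂ b₂) ≃o PolyFace (polyhedron A₁' b₁' A₂' b₂')) :
    ∃ r : Fin 8 → Fin m, IsKleeWalkupLabelling A₁ b₁ A₂ b₂ r := by
  let Q (T : Finset (Fin 8)) : PolyFace (polyhedron A₁' b₁' A₂' b₂') :=
    ⟨labelledFace A₁' b₁' A₂' b₂' r' T, isExposed_tightFace _⟩
  have hfacet : ∀ i, ∃ k, (φ.symm (Q {i})).1 = tightFace A₁ b₁ A₂ b₂ {k} := fun i =>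
    exists_eq_tightFace_singleton
      (PolyFace.maximal_orderIso φ.symm (G := Q {i}) (h'.maximal_singleton i))
  choose r hr using hfacet
  let F (T : Finset (Fin 8)) : PolyFace (polyhedron A₁ b₁ A₂ b₂) :=
    ⟨labelledFace A₁ b₁ A₂ b₂ r T, isExposed_tightFace _⟩
  have hφ : ∀ T, φ (F T) = Q T := by
    intro T
    apply le_antisymm
    · intro x hx
      refine mem_labelledFace.2 ⟨(φ (F T)).2.subset hx, fun i hi => ?_⟩
      have hle : φ (F T) ≤ Q {i} := by
        rw [← φ.le_symm_apply]
        change (F T).1 ⊆ (φ.symm (Q {i})).1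
        rw [hr i, ← labelledFace_singleton]
        exact labelledFace_anti (by simpa using hi)
      exact (mem_labelledFace.1 (hle hx)).2 i (by simp)
    · rw [← φ.symm_apply_le]
      intro x hx
      refine mem_labelledFace.2 ⟨(φ.symm (Q T)).2.subset hx, fun i hi => ?_⟩
      have hle : φ.symm (Q T) ≤ φ.symm (Q {i}) :=
        φ.symm.monotone (show (Q T).1 ⊆ (Q {i}).1 from labelledFace_anti (by simpa using hi))
      have hx' := hle hx
      rw [hr i] at hx'
      exact hx'.2 _ rfl
  have hne : ∀ S T, (Q S).1 ≠ (Q T).1 → (F S).1 ≠ (F T).1 := by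
    intro S T hST hF
    refine hST ?_
    rw [← hφ, ← hφ, Subtype.ext hF]
  refine ⟨r, ?_, ?_, hne _ _ h'.ne_of_ray, hne _ _ h'.ne_of_ray', ?_⟩
  · intro G hG hGne
    obtain ⟨T, hT⟩ := h'.exists_eq (φ ⟨G, hG⟩).1 (φ ⟨G, hG⟩).2
      ((PolyFace.nonempty_orderIso_iff φ).2 hGne)
    refine ⟨T, congrArg Subtype.val (φ.injective (a₁ := ⟨G, hG⟩) (a₂ := F T) ?_)⟩
    rw [hφ]
    exact Subtype.ext hT
  · intro T
    rw [← h'.nonempty_iff T]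
    have := PolyFace.nonempty_orderIso_iff φ (G := F T)
    rw [hφ] at this
    exact this.symm
  · intro i hi
    refine h'.ne_univ i ?_
    have := PolyFace.eq_top_of_orderIso φ (G := F {i}) hi
    rwa [hφ] at this

end Transport

section Model

theorem kleeWalkupA_mulVec (x : Fin 4 → ℝ) :
    kleeWalkupA *ᵥ x = ![-6 * x 0 - 3 * x 1 + x 3, -3 * x 0 - 6 * x 1 + x 2,
      -35 * x 0 - 45 * x 1 + 6 * x 2 + 3 * x 3, -45 * x 0 - 35 * x 1 + 3 * x 2 + 6 * x 3,
      x 0, x 1, x 2, x 3] := by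
  ext i
  fin_cases i <;>
    simp [kleeWalkupA, Matrix.mulVec, dotProduct, Fin.sum_univ_succ] <;> ring

theorem kleeWalkup_not_tight {x : Fin 4 → ℝ} (hx : x ∈ kleeWalkup) :
    ∀ N ∈ kwNonface, ¬ ((kleeWalkupA *ᵥ x) N.1 = kleeWalkupB N.1 ∧
      (kleeWalkupA *ᵥ x) N.2.1 = kleeWalkupB N.2.1 ∧
      (kleeWalkupA *ᵥ x) N.2.2 = kleeWalkupB N.2.2) := by
  have h0 := hx 0
  have h1 := hx 1
  have h2 := hx 2
  have h3 := hx 3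
  have h4 := hx 4
  have h5 := hx 5
  have h6 := hx 6
  have h7 := hx 7
  rw [kleeWalkupA_mulVec]
  simp [kleeWalkupA_mulVec, kleeWalkupB] at h0 h1 h2 h3 h4 h5 h6 h7
  simp only [kwNonface, List.forall_mem_cons, List.not_mem_nil, false_implies, implies_true,
    and_true]
  simp only [kleeWalkupB]
  refine ⟨?_, ?_, ?_, ?_, ?_, ?_, ?_, ?_, ?_, ?_, ?_, ?_, ?_, ?_, ?_, ?_, ?_, ?_, ?_, ?_⟩ <;>
  · rintro ⟨e1, e2, e3⟩
    simp at e1 e2 e3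
    linarith

theorem kleeWalkupA_mulVec_cons (a b c d : ℝ) :
    kleeWalkupA *ᵥ ![a, b, c, d] = ![-6 * a - 3 * b + d, -3 * a - 6 * b + c,
      -35 * a - 45 * b + 6 * c + 3 * d, -45 * a - 35 * b + 3 * c + 6 * d, a, b, c, d] := by
  rw [kleeWalkupA_mulVec]
  rfl

theorem cons_mem_kleeWalkup {a b c d : ℝ} (h : -1 ≤ -6 * a - 3 * b + d ∧
    -1 ≤ -3 * a - 6 * b + c ∧ -8 ≤ -35 * a - 45 * b + 6 * c + 3 * d ∧
    -8 ≤ -45 * a - 35 * b + 3 * c + 6 * d ∧ 0 ≤ a ∧ 0 ≤ b ∧ 0 ≤ c ∧ 0 ≤ d) :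
    ![a, b, c, d] ∈ kleeWalkup := by
  intro i
  rw [kleeWalkupA_mulVec_cons]
  fin_cases i
  exacts [h.1, h.2.1, h.2.2.1, h.2.2.2.1, h.2.2.2.2.1, h.2.2.2.2.2.1, h.2.2.2.2.2.2.1,
    h.2.2.2.2.2.2.2]

theorem exists_kleeWalkup_vertex (a : Fin 15) : ∃ x ∈ kleeWalkup,
    ∀ i ∈ kwLabel a, (kleeWalkupA *ᵥ x) i = kleeWalkupB i := by
  have key : ∀ (T : Finset (Fin 8)) (a b c d : ℝ), ![a, b, c, d] ∈ kleeWalkup →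
      (∀ i ∈ T, ![-6 * a - 3 * b + d, -3 * a - 6 * b + c, -35 * a - 45 * b + 6 * c + 3 * d,
        -45 * a - 35 * b + 3 * c + 6 * d, a, b, c, d] i = kleeWalkupB i) →
      ∃ x ∈ kleeWalkup, ∀ i ∈ T, (kleeWalkupA *ᵥ x) i = kleeWalkupB i := fun T a b c d h1 h2 =>
    ⟨_, h1, by rwa [kleeWalkupA_mulVec_cons]⟩
  fin_cases a
  · refine key _ 1 1 8 8 (cons_mem_kleeWalkup (by norm_num)) ?_
    simp [kwLabel, kleeWalkupB]
    norm_num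
  · refine key _ 0 (1/2) (13/6) (1/2) (cons_mem_kleeWalkup (by norm_num)) ?_
    simp [kwLabel, kleeWalkupB]
    norm_num
  · refine key _ 0 (1/3) (11/9) 0 (cons_mem_kleeWalkup (by norm_num)) ?_
    simp [kwLabel, kleeWalkupB]
    norm_num
  · refine key _ (2/9) 0 0 (1/3) (cons_mem_kleeWalkup (by norm_num)) ?_
    simp [kwLabel, kleeWalkupB]
    norm_num
  · refine key _ (11/75) (1/25) 0 0 (cons_mem_kleeWalkup (by norm_num)) ?_
    simp [kwLabel, kleeWalkupB]
    norm_num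
  · refine key _ (1/6) 0 0 0 (cons_mem_kleeWalkup (by norm_num)) ?_
    simp [kwLabel, kleeWalkupB]
  · refine key _ (1/2) 0 (1/2) (13/6) (cons_mem_kleeWalkup (by norm_num)) ?_
    simp [kwLabel, kleeWalkupB]
    norm_num
  · refine key _ 0 (2/9) (1/3) 0 (cons_mem_kleeWalkup (by norm_num)) ?_
    simp [kwLabel, kleeWalkupB]
    norm_num
  · refine key _ (1/3) 0 0 (11/9) (cons_mem_kleeWalkup (by norm_num)) ?_
    simp [kwLabel, kleeWalkupB]
    norm_num
  · refine key _ (1/25) (11/75) 0 0 (cons_mem_kleeWalkup (by norm_num)) ?_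
    simp [kwLabel, kleeWalkupB]
    norm_num
  · refine key _ 0 (1/6) 0 0 (cons_mem_kleeWalkup (by norm_num)) ?_
    simp [kwLabel, kleeWalkupB]
  · refine key _ 0 (8/25) (16/15) 0 (cons_mem_kleeWalkup (by norm_num)) ?_
    simp [kwLabel, kleeWalkupB]
    norm_num
  · refine key _ (8/25) 0 0 (16/15) (cons_mem_kleeWalkup (by norm_num)) ?_
    simp [kwLabel, kleeWalkupB]
    norm_num
  · refine key _ (1/10) (1/10) 0 0 (cons_mem_kleeWalkup (by norm_num)) ?_
    simp [kwLabel, kleeWalkupB]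
    norm_num
  · refine key _ 0 0 0 0 (cons_mem_kleeWalkup (by norm_num)) ?_
    simp [kwLabel, kleeWalkupB]

theorem kleeWalkup_eq_polyhedron :
    kleeWalkup = polyhedron (0 : Matrix (Fin 0) (Fin 4) ℝ) 0 kleeWalkupA kleeWalkupB := by
  ext x
  simp [kleeWalkup, polyhedron]

theorem isKleeWalkupLabelling_id :
    IsKleeWalkupLabelling (0 : Matrix (Fin 0) (Fin 4) ℝ) 0 kleeWalkupA kleeWalkupB id := by
  classical
  refine ⟨?_, ?_, ?_, ?_, ?_⟩
  · intro F hF hne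
    refine ⟨Finset.univ.filter (· ∈ {i | ∀ x ∈ F, (kleeWalkupA *ᵥ x) i = kleeWalkupB i}), ?_⟩
    rw [labelledFace, Set.image_id]
    simpa using hF.eq_tightFace hne
  · intro T
    constructor
    · rintro ⟨x, hx⟩
      obtain ⟨hxP, hxT⟩ := mem_labelledFace.1 hx
      rw [← kleeWalkup_eq_polyhedron] at hxP
      exact exists_subset_kwLabel T fun N hN ⟨h1, h2, h3⟩ =>
        kleeWalkup_not_tight hxP N hN ⟨hxT _ h1, hxT _ h2, hxT _ h3⟩
    · rintro ⟨a, ha⟩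
      obtain ⟨x, hx, hxa⟩ := exists_kleeWalkup_vertex a
      rw [kleeWalkup_eq_polyhedron] at hx
      exact ⟨x, mem_labelledFace.2 ⟨hx, fun i hi => hxa i (ha hi)⟩⟩
  · intro h
    have hx : ![1 / 3, 0, 0, 2] ∈ labelledFace (0 : Matrix (Fin 0) (Fin 4) ℝ) 0 kleeWalkupA
        kleeWalkupB id {1, 5, 6} := by
      rw [mem_labelledFace, ← kleeWalkup_eq_polyhedron]
      refine ⟨cons_mem_kleeWalkup (by norm_num), ?_⟩
      rw [kleeWalkupA_mulVec_cons]; simp [kleeWalkupB]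
    rw [h, mem_labelledFace, kleeWalkupA_mulVec_cons] at hx
    have := hx.2 2 (by decide)
    simp [kleeWalkupB] at this
    norm_num at this
  · intro h
    have hx : ![1, 0, 7 / 3, 5] ∈ labelledFace (0 : Matrix (Fin 0) (Fin 4) ℝ) 0 kleeWalkupA
        kleeWalkupB id {0, 3, 5} := by
      rw [mem_labelledFace, ← kleeWalkup_eq_polyhedron]
      refine ⟨cons_mem_kleeWalkup (by norm_num), ?_⟩
      rw [kleeWalkupA_mulVec_cons]; simp [kleeWalkupB]; norm_num
    rw [h, mem_labelledFace, kleeWalkupA_mulVec_cons] at hx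
    have := hx.2 6 (by decide)
    simp [kleeWalkupB] at this
  · intro i h
    have hx : (![1 / 60, 1 / 60, 1, 1] : Fin 4 → ℝ) ∈ kleeWalkup :=
      cons_mem_kleeWalkup (by norm_num)
    rw [kleeWalkup_eq_polyhedron, ← h, mem_labelledFace, kleeWalkupA_mulVec_cons] at hx
    have e := hx.2 i (by simp)
    fin_cases i <;> simp [kleeWalkupB] at e <;> norm_num at e

end Model

section Walks

variable {n p m : ℕ} {A₁ : Matrix (Fin p) (Fin n) ℝ} {b₁ : Fin p → ℝ}
  {A₂ : Matrix (Fin m) (Fin n) ℝ} {b₂ : Fin m → ℝ}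

/-- There is a circuit walk of length `k` from `u` to `v`. -/
def HasCircuitWalk (A₁ : Matrix (Fin p) (Fin n) ℝ) (b₁ : Fin p → ℝ)
    (A₂ : Matrix (Fin m) (Fin n) ℝ) (b₂ : Fin m → ℝ) (k : ℕ) (u v : Fin n → ℝ) : Prop :=
  ∃ y, IsCircuitWalk A₁ b₁ A₂ b₂ u v k y

theorem hasCircuitWalk_zero {u : Fin n → ℝ} (hu : u ∈ polyhedron A₁ b₁ A₂ b₂) :
    HasCircuitWalk A₁ b₁ A₂ b₂ 0 u u :=
  ⟨fun _ => u, rfl, rfl, fun _ => hu, fun i => i.elim0⟩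

theorem HasCircuitWalk.cons {k : ℕ} {u v w : Fin n → ℝ} (h : HasCircuitWalk A₁ b₁ A₂ b₂ k v w)
    (hu : u ∈ polyhedron A₁ b₁ A₂ b₂) (hs : IsCircuitStep A₁ b₁ A₂ b₂ u v) :
    HasCircuitWalk A₁ b₁ A₂ b₂ (k + 1) u w := by
  obtain ⟨y, hy0, hyk, hyP, hy⟩ := h
  refine ⟨Fin.cons u y, rfl, ?_, ?_, ?_⟩
  · rw [← Fin.succ_last, Fin.cons_succ, hyk]
  · intro i
    refine Fin.cases ?_ (fun i => ?_) i
    · exact hu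
    · exact hyP i
  · intro i
    refine Fin.cases ?_ (fun i => ?_) i
    · simpa [hy0] using hs
    · rw [← Fin.succ_castSucc, Fin.cons_succ, Fin.cons_succ]
      exact hy i

theorem HasCircuitWalk.circuitDist_le {k : ℕ} {u v : Fin n → ℝ}
    (h : HasCircuitWalk A₁ b₁ A₂ b₂ k u v) : circuitDist A₁ b₁ A₂ b₂ u v ≤ k :=
  iInf₂_le k h

/-- If the inequalities in `S` together with the inequality `j` determine a direction in the span
of the polyhedron, then a move that keeps the values of `S` and makes `j` tight is a circuit
step. -/
theorem isCircuitStep_of_determined {S : Set (Fin m)} {j : Fin m} {x y : Fin n → ℝ}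
    (hS : ∀ d, A₁ *ᵥ d = 0 → (∀ i ∈ S, (A₂ *ᵥ d) i = 0) → (A₂ *ᵥ d) j = 0 → d = 0)
    (hx : x ∈ polyhedron A₁ b₁ A₂ b₂) (hy : y ∈ polyhedron A₁ b₁ A₂ b₂)
    (hxy : ∀ i ∈ S, (A₂ *ᵥ x) i = (A₂ *ᵥ y) i)
    (hxj : (A₂ *ᵥ x) j ≠ b₂ j) (hyj : (A₂ *ᵥ y) j = b₂ j) :
    IsCircuitStep A₁ b₁ A₂ b₂ x y := by
  have hlt : b₂ j < (A₂ *ᵥ x) j := lt_of_le_of_ne (hx.2 j) hxj.symm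
  have hg : A₁ *ᵥ (y - x) = 0 := mulVec_sub_eq_zero hy hx
  have hgS : ∀ i ∈ S, (A₂ *ᵥ (y - x)) i = 0 := fun i hi => by
    rw [mulVec_sub_apply, hxy i hi, sub_self]
  have hgj : (A₂ *ᵥ (y - x)) j < 0 := by
    rw [mulVec_sub_apply, hyj]; linarith
  refine ⟨y - x, 1, ⟨hg, ?_, ?_⟩, one_pos, (one_smul _ _).symm, ?_⟩
  · intro h0
    rw [h0, Matrix.mulVec_zero] at hgj
    exact lt_irrefl _ hgj
  · intro h hh hne hss
    set c := (A₂ *ᵥ h) j / (A₂ *ᵥ (y - x)) j with hc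
    have hcg : h + (-c) • (y - x) = 0 := by
      refine hS _ ?_ (fun i hi => ?_) ?_
      · rw [Matrix.mulVec_add, Matrix.mulVec_smul, hh, hg, smul_zero, add_zero]
      · have hi0 : (A₂ *ᵥ h) i = 0 := by
          by_contra hne'
          exact hss.1 hne' (hgS i hi)
        rw [mulVec_add_smul_apply, hi0, hgS i hi]
        simp
      · rw [mulVec_add_smul_apply, hc]
        have := hgj.ne
        field_simp
        ring
    have hh' : h = c • (y - x) := by
      rw [neg_smul, ← sub_eq_add_neg] at hcg
      exact sub_eq_zero.1 hcg
    have hc0 : c ≠ 0 := by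
      intro h0
      rw [h0, zero_smul] at hh'
      exact hne hh'
    refine hss.2 fun i hi => ?_
    rw [Function.mem_support] at hi ⊢
    rw [hh', Matrix.mulVec_smul]
    exact mul_ne_zero hc0 hi
  · intro β hβ hmem
    have := hmem.2 j
    rw [mulVec_add_smul_apply] at this
    rw [mulVec_sub_apply, hyj] at this
    nlinarith

namespace IsKleeWalkupLabelling

variable {r : Fin 8 → Fin m}

theorem exists_eq_singleton (h : IsKleeWalkupLabelling A₁ b₁ A₂ b₂ r)
    (hpt : ∀ d, A₁ *ᵥ d = 0 → A₂ *ᵥ d = 0 → d = 0) (a : Fin 15) :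
    ∃ w, labelledFace A₁ b₁ A₂ b₂ r (kwLabel a) = {w} := by
  obtain ⟨w, hw⟩ := (h.nonempty_iff (kwLabel a)).2 ⟨a, subset_rfl⟩
  refine ⟨w, Set.Subsingleton.eq_singleton_of_mem ?_ hw⟩
  refine tightFace_subsingleton_of_minimal hpt fun T hT hne => ?_
  obtain ⟨T', hT'⟩ := h.exists_eq _ (isExposed_tightFace T) hne
  rw [hT'] at hne ⊢
  obtain ⟨x, hx⟩ := hne
  exact labelledFace_anti (h.mem_kwLabel_of_subset
    ⟨x, tightFace_anti hT (by rw [hT']; exact hx), hx⟩)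

theorem exists_vertex_of_mem_extremePoints (h : IsKleeWalkupLabelling A₁ b₁ A₂ b₂ r)
    {u : Fin n → ℝ} (hu : u ∈ (polyhedron A₁ b₁ A₂ b₂).extremePoints ℝ) :
    ∃ a, labelledFace A₁ b₁ A₂ b₂ r (kwLabel a) = {u} := by
  have hF := tightFace_eq_singleton_of_mem_extremePoints hu
  obtain ⟨T, hT⟩ := h.exists_eq _ (isExposed_tightFace _) (hF ▸ Set.singleton_nonempty u)
  rw [hF] at hT
  obtain ⟨a, ha⟩ := (h.nonempty_iff T).1 (hT ▸ Set.singleton_nonempty u)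
  refine ⟨a, ((h.nonempty_iff _).2 ⟨a, subset_rfl⟩).subset_singleton_iff.1 ?_⟩
  rw [hT]
  exact labelledFace_anti ha

theorem not_tight (h : IsKleeWalkupLabelling A₁ b₁ A₂ b₂ r) {a : Fin 15} {w : Fin n → ℝ}
    (hw : w ∈ labelledFace A₁ b₁ A₂ b₂ r (kwLabel a)) {i : Fin 8} (hi : i ∉ kwLabel a) :
    (A₂ *ᵥ w) (r i) ≠ b₂ (r i) := by
  intro htight
  refine hi ?_
  have := h.mem_kwLabel_of_subset (a := a) (T := {i})
    ⟨w, hw, mem_labelledFace.2 ⟨hw.1, by simpa using htight⟩⟩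
  simpa using this

/-- The four facet inequalities of a vertex determine a direction in the span of the
polyhedron. -/
theorem eq_zero_of_vertex (h : IsKleeWalkupLabelling A₁ b₁ A₂ b₂ r) {a : Fin 15}
    {w : Fin n → ℝ} (hw : labelledFace A₁ b₁ A₂ b₂ r (kwLabel a) = {w}) {d : Fin n → ℝ}
    (hd : A₁ *ᵥ d = 0)
    (hd0 : ∀ j, tightFace A₁ b₁ A₂ b₂ {j} = polyhedron A₁ b₁ A₂ b₂ → (A₂ *ᵥ d) j = 0)
    (hda : ∀ i ∈ kwLabel a, (A₂ *ᵥ d) (r i) = 0) : d = 0 := by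
  have hwm : w ∈ labelledFace A₁ b₁ A₂ b₂ r (kwLabel a) := by rw [hw]; rfl
  have hwt := (mem_labelledFace.1 hwm).2
  obtain ⟨ε, hε, hs⟩ := exists_pos_forall_add_mul_nonneg
    (fun i => (A₂ *ᵥ w) (r i) - b₂ (r i)) (fun i => (A₂ *ᵥ d) (r i))
  have hz : w + ε • d ∈ polyhedron A₁ b₁ A₂ b₂ := by
    refine mem_polyhedron_of_facet_inequalities (r := r) ⟨w, hwm.1⟩
      (fun i => by rw [← labelledFace_singleton]; exact h.ne_univ i) (fun j hj hne => ?_)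
      (mulVec_add_smul_eq hwm.1 hd ε) (fun j hj => ?_) fun i => ?_
    · obtain ⟨i, hi⟩ := h.exists_subset_singleton (isExposed_tightFace {j}) hne hj
      exact ⟨i, by rwa [← labelledFace_singleton]⟩
    · have hwj : w ∈ tightFace A₁ b₁ A₂ b₂ {j} := by rw [hj]; exact hwm.1
      rw [mulVec_add_smul_apply, hd0 j hj, hwj.2 j rfl]
      simp
    · rw [mulVec_add_smul_apply]
      by_cases hi : i ∈ kwLabel a
      · rw [hda i hi, hwt i hi]; simp
      · have := hs i (sub_pos.2 (lt_of_le_of_ne (hwm.1.2 _) (h.not_tight hwm hi).symm))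
        linarith
  have hza : w + ε • d ∈ labelledFace A₁ b₁ A₂ b₂ r (kwLabel a) :=
    mem_tightFace_add_smul hwm (by rintro _ ⟨i, hi, rfl⟩; exact hda i hi) hz
  rw [hw, Set.mem_singleton_iff, add_eq_left] at hza
  exact (smul_eq_zero.1 hza).resolve_left hε.ne'

theorem isCircuitStep (h : IsKleeWalkupLabelling A₁ b₁ A₂ b₂ r) {a : Fin 15} {w : Fin n → ℝ}
    (hw : labelledFace A₁ b₁ A₂ b₂ r (kwLabel a) = {w}) {j : Fin 8}
    {x y : Fin n → ℝ} (hx : x ∈ polyhedron A₁ b₁ A₂ b₂) (hy : y ∈ polyhedron A₁ b₁ A₂ b₂)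
    (hxy : ∀ i ∈ kwLabel a, i ≠ j → (A₂ *ᵥ x) (r i) = (A₂ *ᵥ y) (r i))
    (hxj : (A₂ *ᵥ x) (r j) ≠ b₂ (r j)) (hyj : (A₂ *ᵥ y) (r j) = b₂ (r j)) :
    IsCircuitStep A₁ b₁ A₂ b₂ x y := by
  refine isCircuitStep_of_determined (S := {k | (A₂ *ᵥ x) k = (A₂ *ᵥ y) k}) (j := r j)
    (fun d hd hdS hdj => h.eq_zero_of_vertex hw hd (fun k hk => hdS k ?_) fun i hi => ?_)
    hx hy (fun i hi => hi) hxj hyj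
  · have hxk : x ∈ tightFace A₁ b₁ A₂ b₂ {k} := by rw [hk]; exact hx
    have hyk : y ∈ tightFace A₁ b₁ A₂ b₂ {k} := by rw [hk]; exact hy
    exact (hxk.2 k rfl).trans (hyk.2 k rfl).symm
  · by_cases hij : i = j
    · rwa [hij]
    · exact hdS _ (hxy i hi hij)

/-- On an unbounded edge, the inequality that is tight at its only vertex takes all larger
values. -/
theorem exists_mem_ray (h : IsKleeWalkupLabelling A₁ b₁ A₂ b₂ r) {a : Fin 15} {w : Fin n → ℝ}
    (hw : labelledFace A₁ b₁ A₂ b₂ r (kwLabel a) = {w}) {T : Finset (Fin 8)} {j : Fin 8}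
    (hT : kwLabel a = insert j T) (hTc : ∀ c, T ⊆ kwLabel c → c = a)
    (hne : labelledFace A₁ b₁ A₂ b₂ r T ≠ labelledFace A₁ b₁ A₂ b₂ r (kwLabel a))
    {s : ℝ} (hs : b₂ (r j) ≤ s) :
    ∃ y ∈ labelledFace A₁ b₁ A₂ b₂ r T, (A₂ *ᵥ y) (r j) = s := by
  have hsub : labelledFace A₁ b₁ A₂ b₂ r (kwLabel a) ⊆ labelledFace A₁ b₁ A₂ b₂ r T :=
    labelledFace_anti (by rw [hT]; exact Finset.subset_insert j T)
  have hmem : ∀ z ∈ labelledFace A₁ b₁ A₂ b₂ r T, (A₂ *ᵥ z) (r j) = b₂ (r j) → z = w := by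
    intro z hz hzj
    have : z ∈ labelledFace A₁ b₁ A₂ b₂ r (kwLabel a) := by
      rw [hT, mem_labelledFace]
      refine ⟨hz.1, fun i hi => ?_⟩
      rcases Finset.mem_insert.1 hi with rfl | hi
      exacts [hzj, (mem_labelledFace.1 hz).2 i hi]
    rwa [hw] at this
  have hwa : w ∈ labelledFace A₁ b₁ A₂ b₂ r (kwLabel a) := by rw [hw]; rfl
  have hwj : (A₂ *ᵥ w) (r j) = b₂ (r j) :=
    (mem_labelledFace.1 hwa).2 j (by rw [hT]; exact Finset.mem_insert_self j T)
  obtain ⟨x, hx, hxa⟩ : ∃ x ∈ labelledFace A₁ b₁ A₂ b₂ r T,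
      x ∉ labelledFace A₁ b₁ A₂ b₂ r (kwLabel a) := by
    by_contra! hall
    exact hne (Set.Subset.antisymm hall hsub)
  have hxw : x ≠ w := by
    rintro rfl
    exact hxa hwa
  have hxj : b₂ (r j) < (A₂ *ᵥ x) (r j) :=
    lt_of_le_of_ne (hx.1.2 _) fun he => hxw (hmem x hx he.symm)
  have hpos := sub_pos.2 hxj
  refine ⟨w + ((s - b₂ (r j)) / ((A₂ *ᵥ x) (r j) - b₂ (r j))) • (x - w),
    add_smul_mem_of_forall_face_eq (hsub hwa) hx hxw (fun U hU hUne => ?_)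
      (div_nonneg (sub_nonneg.2 hs) hpos.le), ?_⟩
  · obtain ⟨T', hT'⟩ := h.exists_eq _ (isExposed_tightFace U) hUne
    have hUT := tightFace_anti (A₁ := A₁) (b₁ := b₁) (A₂ := A₂) (b₂ := b₂) hU
    rw [hT'] at hUne hUT ⊢
    have hTT' : (labelledFace A₁ b₁ A₂ b₂ r (T ∪ T')).Nonempty := by
      rw [labelledFace_union]
      obtain ⟨z, hz⟩ := hUne
      exact ⟨z, hUT hz, hz⟩
    obtain ⟨c, hc⟩ := (h.nonempty_iff _).1 hTT'
    rw [hTc c (Finset.union_subset_left hc), hT] at hc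
    by_cases hj : j ∈ T'
    · right
      exact fun z hz => hmem z (hUT hz) ((mem_labelledFace.1 hz).2 j hj)
    · left
      exact labelledFace_anti
        ((Finset.subset_insert_iff_of_notMem hj).1 (Finset.union_subset_right hc))
  · rw [mulVec_add_smul_apply, mulVec_sub_apply, hwj]
    field_simp
    ring

/-- A shortcut through an unbounded edge: move parallel to a facet of a vertex of that edge until
the edge is reached, and then along the edge to its vertex. -/
theorem hasCircuitWalk_of_ray (h : IsKleeWalkupLabelling A₁ b₁ A₂ b₂ r) {a c : Fin 15}
    {u w v : Fin n → ℝ} (hu : u ∈ labelledFace A₁ b₁ A₂ b₂ r (kwLabel a))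
    (hw : labelledFace A₁ b₁ A₂ b₂ r (kwLabel c) = {w}) {T : Finset (Fin 8)} {i j : Fin 8}
    (hT : kwLabel c = insert j T) (hTc : ∀ c', T ⊆ kwLabel c' → c' = c)
    (hne : labelledFace A₁ b₁ A₂ b₂ r T ≠ labelledFace A₁ b₁ A₂ b₂ r (kwLabel c))
    (hi : i ∈ T) (hia : i ∉ kwLabel a) (hja : j ∉ kwLabel a) (hTa : T.erase i ⊆ kwLabel a)
    {k : ℕ} (hwalk : HasCircuitWalk A₁ b₁ A₂ b₂ k w v) :
    HasCircuitWalk A₁ b₁ A₂ b₂ (k + 2) u v := by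
  obtain ⟨y, hy, hyj⟩ := h.exists_mem_ray hw hT hTc hne (hu.1.2 (r j))
  have hyT := (mem_labelledFace.1 hy).2
  have huT := (mem_labelledFace.1 hu).2
  have hwm : w ∈ labelledFace A₁ b₁ A₂ b₂ r (kwLabel c) := by rw [hw]; rfl
  have hwT := (mem_labelledFace.1 hwm).2
  refine (hwalk.cons hy.1 (h.isCircuitStep hw (j := j) hy.1 hwm.1 (fun l hl hlj => ?_) ?_ ?_)).cons
    hu.1 (h.isCircuitStep hw (j := i) hu.1 hy.1 (fun l hl hli => ?_) (h.not_tight hu hia)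
      (hyT i hi))
  · rw [hwT l hl, hyT l]
    rw [hT] at hl
    exact (Finset.mem_insert.1 hl).resolve_left hlj
  · rw [hyj]
    exact h.not_tight hu hja
  · exact hwT j (by rw [hT]; exact Finset.mem_insert_self j T)
  · rw [hT] at hl
    rcases Finset.mem_insert.1 hl with rfl | hl
    · exact hyj.symm
    · rw [hyT l hl, huT l (hTa (Finset.mem_erase.2 ⟨hli, hl⟩))]

end IsKleeWalkupLabelling

/-- The neighbours of the vertices of the Klee–Walkup polyhedron along bounded edges. -/
def kwNeighbors : Fin 15 → List (Fin 15) :=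
  ![[1, 6], [0, 2, 11], [1, 4, 11], [4, 5, 12], [2, 3, 5, 13], [3, 4, 14], [0, 8, 12],
    [9, 10, 11], [6, 9, 12], [7, 8, 10, 13], [7, 9, 14], [1, 2, 7, 13], [3, 6, 8, 13],
    [4, 9, 11, 12], [5, 10]]

/-- Whether two vertices have distance at most `k` in the graph of the Klee–Walkup polyhedron. -/
def kwWithin : ℕ → Fin 15 → Fin 15 → Bool
  | 0, a, b => a == b
  | k + 1, a, b => a == b || (kwNeighbors a).any fun c => kwWithin k c b

set_option maxRecDepth 100000 in
theorem kwWithin_four : ∀ a b : Fin 15, kwWithin 4 a b ∨ (a = 14 ∧ b = 0) ∨ (a = 0 ∧ b = 14) := by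
  decide

theorem exists_of_mem_kwNeighbors : ∀ a, ∀ b ∈ kwNeighbors a,
    ∃ j ∈ kwLabel b, j ∉ kwLabel a ∧ ∀ i ∈ kwLabel b, i ≠ j → i ∈ kwLabel a := by
  decide

namespace IsKleeWalkupLabelling

variable {r : Fin 8 → Fin m} {w : Fin 15 → Fin n → ℝ}

theorem hasCircuitWalk_of_kwWithin (h : IsKleeWalkupLabelling A₁ b₁ A₂ b₂ r)
    (hw : ∀ a, labelledFace A₁ b₁ A₂ b₂ r (kwLabel a) = {w a}) {k : ℕ} {a b : Fin 15}
    (hab : kwWithin k a b) : ∃ l ≤ k, HasCircuitWalk A₁ b₁ A₂ b₂ l (w a) (w b) := by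
  have hwm : ∀ a, w a ∈ labelledFace A₁ b₁ A₂ b₂ r (kwLabel a) := fun a => by rw [hw a]; rfl
  induction k generalizing a with
  | zero =>
    obtain rfl : a = b := by simpa [kwWithin] using hab
    exact ⟨0, le_rfl, hasCircuitWalk_zero (hwm a).1⟩
  | succ k ih =>
    simp only [kwWithin, Bool.or_eq_true, beq_iff_eq, List.any_eq_true] at hab
    rcases hab with rfl | ⟨c, hc, hcb⟩
    · exact ⟨0, Nat.zero_le _, hasCircuitWalk_zero (hwm a).1⟩
    · obtain ⟨l, hl, hwalk⟩ := ih hcb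
      obtain ⟨j, hj, hja, hjc⟩ := exists_of_mem_kwNeighbors a c hc
      have ha := (mem_labelledFace.1 (hwm a)).2
      have hc' := (mem_labelledFace.1 (hwm c)).2
      exact ⟨l + 1, Nat.succ_le_succ hl, hwalk.cons (hwm a).1
        (h.isCircuitStep (hw c) (j := j) (hwm a).1 (hwm c).1
          (fun i hi hij => by rw [ha i (hjc i hi hij), hc' i hi]) (h.not_tight (hwm a) hja)
          (hc' j hj))⟩

theorem exists_hasCircuitWalk_le_four (h : IsKleeWalkupLabelling A₁ b₁ A₂ b₂ r)
    (hw : ∀ a, labelledFace A₁ b₁ A₂ b₂ r (kwLabel a) = {w a}) (a b : Fin 15) :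
    ∃ l ≤ 4, HasCircuitWalk A₁ b₁ A₂ b₂ l (w a) (w b) := by
  have hwm : ∀ a, w a ∈ labelledFace A₁ b₁ A₂ b₂ r (kwLabel a) := fun a => by rw [hw a]; rfl
  rcases kwWithin_four a b with hab | ⟨rfl, rfl⟩ | ⟨rfl, rfl⟩
  · exact h.hasCircuitWalk_of_kwWithin hw hab
  · obtain ⟨l, hl, hwalk⟩ := h.hasCircuitWalk_of_kwWithin hw
      (show kwWithin 2 8 0 by decide)
    exact ⟨l + 2, by omega, h.hasCircuitWalk_of_ray (hwm 14) (hw 8) (T := {1, 5, 6}) (i := 1)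
      (j := 2) (by decide) (by decide) h.ne_of_ray (by decide) (by decide) (by decide) (by decide)
      hwalk⟩
  · obtain ⟨l, hl, hwalk⟩ := h.hasCircuitWalk_of_kwWithin hw
      (show kwWithin 2 3 14 by decide)
    exact ⟨l + 2, by omega, h.hasCircuitWalk_of_ray (hwm 0) (hw 3) (T := {0, 3, 5}) (i := 5)
      (j := 6) (by decide) (by decide) h.ne_of_ray' (by decide) (by decide) (by decide)
      (by decide) hwalk⟩

theorem circuitDiameter_le (h : IsKleeWalkupLabelling A₁ b₁ A₂ b₂ r) :
    circuitDiameter A₁ b₁ A₂ b₂ ≤ 4 := by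
  refine iSup₂_le fun u hu => iSup₂_le fun v hv => ?_
  have hpt : ∀ d, A₁ *ᵥ d = 0 → A₂ *ᵥ d = 0 → d = 0 := fun d h1 h2 =>
    eq_zero_of_mem_extremePoints hu h1 fun i _ => congrFun h2 i
  choose w hw using h.exists_eq_singleton hpt
  obtain ⟨a, ha⟩ := h.exists_vertex_of_mem_extremePoints hu
  obtain ⟨b, hb⟩ := h.exists_vertex_of_mem_extremePoints hv
  obtain rfl : w a = u := Set.singleton_injective ((hw a).symm.trans ha)
  obtain rfl : w b = v := Set.singleton_injective ((hw b).symm.trans hb)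
  obtain ⟨l, hl, hwalk⟩ := h.exists_hasCircuitWalk_le_four hw a b
  exact hwalk.circuitDist_le.trans (by exact_mod_cast hl)

end IsKleeWalkupLabelling

end Walks

theorem theorem1 {n p m : ℕ} (A₁ : Matrix (Fin p) (Fin n) ℝ) (b₁ : Fin p → ℝ)
    (A₂ : Matrix (Fin m) (Fin n) ℝ) (b₂ : Fin m → ℝ)
    (hP : IsRealizationU4 (polyhedron A₁ b₁ A₂ b₂)) :
    circuitDiameter A₁ b₁ A₂ b₂ ≤ 4 ∧
      (numFacets (polyhedron A₁ b₁ A₂ b₂) : ℤ) - polyDim (polyhedron A₁ b₁ A₂ b₂) = 4 := by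
  obtain ⟨hdim, hcomb⟩ := hP
  rw [kleeWalkup_eq_polyhedron] at hcomb
  obtain ⟨φ⟩ := hcomb
  obtain ⟨r, h⟩ := isKleeWalkupLabelling_id.exists_of_orderIso φ
  refine ⟨h.circuitDiameter_le, ?_⟩
  rw [h.numFacets_eq, hdim]
  norm_num
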